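/- Let $H(\mathbb{C})$ be the complex Fréchet space of entire functions of one complex variable, with the topology of uniform convergence on compact sets, let $D : H(\mathbb{C}) \to H(\mathbb{C})$, $Df = f'$, be the (continuous linear) differentiation operator, and let $I$ be the identity operator. A vector $f \in H(\mathbb{C})$ is called hypercyclic for a continuous linear operator $T$ on $H(\mathbb{C})$ if the orbit $\{T^n f : n = 0, 1, 2, \dots\}$ is dense in $H(\mathbb{C})$; a common hypercyclic vector of a family of operators is a vector that is hypercyclic for every member of the family. (i) The family $\{aD + bI : a > 0,\ b \in \mathbb{C}\}$ has no common hypercyclic vector. (ii) Consequently, the answer to the following question of Aron is negative: is there a common hypercyclic vector for the family of all continuous linear operators on $H(\mathbb{C})$ that commute with $D$ and are not scalar multiples of the identity? That is, this family has no common hypercyclic vector. -/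

import Mathlib

open Topology Filter

/-- The set of hypercyclic vectors of a continuous linear operator `T` on a complex topological
vector space: those `x` whose orbit `{T ^ n x : n = 0, 1, 2, …}` is dense. -/
def hypercyclicVectors {X : Type*} [AddCommGroup X] [Module ℂ X] [TopologicalSpace X]
    (T : X →L[ℂ] X) : Set X :=
  {x | Dense (Set.range fun n : ℕ => (T ^ n) x)}

/-- The set of common hypercyclic vectors of a family of operators: the vectors that are
hypercyclic for every member of the family. -/
def commonHypercyclicVectors {X : Type*} [AddCommGroup X] [Module ℂ X] [TopologicalSpace X]
    (F : Set (X →L[ℂ] X)) : Set X :=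
  ⋂ T ∈ F, hypercyclicVectors T

/-- The entire functions of one complex variable, as a subspace of `C(ℂ, ℂ)`. -/
def entireSubmodule : Submodule ℂ C(ℂ, ℂ) where
  carrier := {f | Differentiable ℂ f}
  add_mem' hf hg := Differentiable.add hf hg
  zero_mem' := differentiable_const (0 : ℂ)
  smul_mem' c _ hf := Differentiable.const_smul hf c

/-- The space `H(ℂ)` of entire functions of one complex variable. -/
def EntireFunctions : Type := entireSubmodule

namespace EntireFunctions

noncomputable instance : AddCommGroup EntireFunctions :=
  inferInstanceAs (AddCommGroup entireSubmodule)

noncomputable instance : Module ℂ EntireFunctions :=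
  inferInstanceAs (Module ℂ entireSubmodule)

/-- The topology of uniform convergence on compact sets, as induced by the compact-open topology
of `C(ℂ, ℂ)`. -/
instance : TopologicalSpace EntireFunctions :=
  inferInstanceAs (TopologicalSpace entireSubmodule)

instance : IsTopologicalAddGroup EntireFunctions :=
  inferInstanceAs (IsTopologicalAddGroup entireSubmodule)

instance : ContinuousSMul ℂ EntireFunctions :=
  inferInstanceAs (ContinuousSMul ℂ entireSubmodule)

noncomputable instance : FunLike EntireFunctions ℂ ℂ where
  coe f := f.1
  coe_injective _ _ h := Subtype.ext (DFunLike.coe_injective h)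

theorem differentiable (f : EntireFunctions) : Differentiable ℂ f := f.2

/-- Build an element of `H(ℂ)` from a complex differentiable function. -/
def mk (f : ℂ → ℂ) (hf : Differentiable ℂ f) : EntireFunctions :=
  ⟨⟨f, hf.continuous⟩, hf⟩

theorem differentiable_deriv (f : EntireFunctions) : Differentiable ℂ (deriv f) :=
  fun _ => (f.differentiable.differentiableOn.deriv isOpen_univ).differentiableAt univ_mem

/-- Differentiation `f ↦ f'` as a linear map on `H(ℂ)`. -/
noncomputable def derivLinear : EntireFunctions →ₗ[ℂ] EntireFunctions where
  toFun f := mk (deriv f) f.differentiable_deriv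
  map_add' f g := DFunLike.ext _ _ fun z => deriv_add (f.differentiable z) (g.differentiable z)
  map_smul' c f := DFunLike.ext _ _ fun z => deriv_const_smul c (f.differentiable z)

theorem continuous_derivLinear : Continuous derivLinear := by
  refine Continuous.subtype_mk (continuous_iff_continuousAt.2 fun f => ?_) _
  refine ContinuousMap.tendsto_iff_tendstoLocallyUniformly.2 ?_
  have h : TendstoLocallyUniformly (fun (g : EntireFunctions) z => g z) f (𝓝 f) :=
    ContinuousMap.tendsto_iff_tendstoLocallyUniformly.1 continuous_subtype_val.continuousAt
  have h' := (tendstoLocallyUniformlyOn_univ.2 h).deriv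
    (Eventually.of_forall fun g => g.differentiable.differentiableOn) isOpen_univ
  exact tendstoLocallyUniformlyOn_univ.1 h'

/-- The differentiation operator `D f = f'`, a continuous linear operator on `H(ℂ)`. -/
noncomputable def D : EntireFunctions →L[ℂ] EntireFunctions :=
  ⟨derivLinear, continuous_derivLinear⟩

end EntireFunctions

/-! Suppose `x` is hypercyclic for every `t (T + c I)` with `t ∈ (1, 2)` and `c` small. The
polynomials `P n (c) = φ ((T + c I) ^ n x)` form an Appell sequence: `P (n + 1)' = (n + 1) P n`.
Each time the orbit comes near `u`, the numbers `t ^ n P n (c)`, `t ^ n P (n + 1) (c)`, `t ^ n P (n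
+ 2) (c)` are close to `0`, `1`, `2 c`. The Newton quotient `p / p'` of `p = P (n + 2)` is then `O(1
/ n)` at `c`, with derivative bounded away from `0`. This quotient takes each value at most `n + 2`
times, so such `c` fill an area `(n + 2) * O(1 / n ^ 2) = O(1 / n)` (`volume_setOf_newton_le`). For
each `c`, the admissible `t` have length `O(1 / n)` (`volume_setOf_pow_mul_le`). The pairs `(c, t)`
thus have measure `O(1 / n ^ 2)`, which is summable. By Borel–Cantelli almost every pair occurs
finitely often, whereas hypercyclicity makes every pair occur infinitely often. -/

open MeasureTheory Set

/-! ### Area expansion by holomorphic maps of bounded multiplicity -/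

/-- The real determinant of multiplication by a complex number is the square of its norm. -/
theorem det_restrictScalars_toSpanSingleton (a : ℂ) :
    ((ContinuousLinearMap.toSpanSingleton ℂ a).restrictScalars ℝ).det = ‖a‖ ^ 2 := by
  have h : (((ContinuousLinearMap.toSpanSingleton ℂ a).restrictScalars ℝ : ℂ →L[ℝ] ℂ) :
      ℂ →ₗ[ℝ] ℂ) = LinearMap.mul ℝ ℂ a := by
    ext
    all_goals simp [mul_comm]
  rw [ContinuousLinearMap.det, h, ← Complex.normSq_eq_norm_sq]
  have := Algebra.norm_complex_apply a
  rwa [Algebra.norm_apply] at this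

/-- A holomorphic function with nonvanishing derivative on an open set is injective on each piece
of some countable measurable partition. -/
theorem exists_measurable_partition_injOn {g : ℂ → ℂ} {S : Set ℂ} (hS : IsOpen S)
    (hg : DifferentiableOn ℂ g S) (hg' : ∀ z ∈ S, deriv g z ≠ 0) :
    ∃ W : ℕ → Set ℂ, (∀ i, MeasurableSet (W i)) ∧ Pairwise (Function.onFun Disjoint W) ∧
      (⋃ i, W i) = S ∧ ∀ i, InjOn g (W i) := by
  have hloc : ∀ z ∈ S, ∃ V : Set ℂ, IsOpen V ∧ z ∈ V ∧ InjOn g V := fun z hz => by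
    have h := (hg.analyticAt (hS.mem_nhds hz)).hasStrictDerivAt.hasStrictFDerivAt_equiv (hg' z hz)
    exact ⟨_, (h.toOpenPartialHomeomorph g).open_source, h.mem_toOpenPartialHomeomorph_source,
      (h.toOpenPartialHomeomorph g).injOn⟩
  choose! V hVo hzV hV using hloc
  rcases S.eq_empty_or_nonempty with rfl | hne
  · exact ⟨fun _ => ∅, by simp, fun _ _ _ => by simp [Function.onFun], by simp, by simp⟩
  obtain ⟨t, hts, htc, hcov⟩ := TopologicalSpace.countable_cover_nhdsWithin
    (fun z hz => mem_nhdsWithin_of_mem_nhds ((hVo z hz).mem_nhds (hzV z hz)))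
  have htne : t.Nonempty := by
    obtain ⟨z, hz⟩ := hne
    obtain ⟨i, hi, _⟩ := mem_iUnion₂.1 (hcov hz)
    exact ⟨i, hi⟩
  obtain ⟨e, rfl⟩ := htc.exists_eq_range htne
  have he : ∀ i, e i ∈ S := fun i => hts (mem_range_self i)
  refine ⟨disjointed fun i => V (e i) ∩ S,
    MeasurableSet.disjointed fun i => ((hVo _ (he i)).inter hS).measurableSet,
    disjoint_disjointed _, ?_, fun i => ?_⟩
  · rw [iUnion_disjointed, ← iUnion_inter]
    exact inter_eq_right.2 (by simpa using hcov)
  · exact (hV _ (he i)).mono ((disjointed_subset _ i).trans inter_subset_left)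

/-- If a holomorphic map has derivative at least `δ` in modulus and takes each value at most `m`
times on an open set `S`, then it expands the total area by at least `δ ^ 2 / m`. -/
theorem volume_le_of_encard_fiber_le {g : ℂ → ℂ} {S B : Set ℂ} {δ : ℝ} {m : ℕ} (hδ : 0 < δ)
    (hS : IsOpen S) (hg : DifferentiableOn ℂ g S) (hg' : ∀ z ∈ S, δ ≤ ‖deriv g z‖)
    (hfib : ∀ w, (S ∩ g ⁻¹' {w}).encard ≤ m) (hmaps : MapsTo g S B) :
    ENNReal.ofReal (δ ^ 2) * volume S ≤ m * volume B := by
  obtain ⟨W, hWm, hWd, hWS, hWi⟩ := exists_measurable_partition_injOn hS hg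
    fun z hz => norm_pos_iff.1 (hδ.trans_le (hg' z hz))
  have hsub : ∀ i, W i ⊆ S := fun i => hWS ▸ subset_iUnion W i
  have hder : ∀ i, ∀ z ∈ W i, HasFDerivWithinAt g
      ((ContinuousLinearMap.toSpanSingleton ℂ (deriv g z)).restrictScalars ℝ) (W i) z :=
    fun i z hz => (((hg.differentiableAt (hS.mem_nhds (hsub i hz))).hasDerivAt.hasFDerivAt
      ).restrictScalars ℝ).hasFDerivWithinAt
  have himm : ∀ i, MeasurableSet (g '' W i) := fun i =>
    measurable_image_of_fderivWithin (hWm i) (hder i) (hWi i)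
  have hpiece : ∀ i, ENNReal.ofReal (δ ^ 2) * volume (W i) ≤ volume (g '' W i) := fun i => by
    rw [← lintegral_abs_det_fderiv_eq_addHaar_image volume (hWm i) (hder i) (hWi i),
      ← setLIntegral_const]
    refine setLIntegral_mono' (hWm i) fun z hz => ENNReal.ofReal_le_ofReal ?_
    rw [det_restrictScalars_toSpanSingleton, abs_of_nonneg (by positivity)]
    exact pow_le_pow_left₀ hδ.le (hg' z (hsub i hz)) 2
  -- The pieces are disjoint, so different pieces whose images contain `w` give different points of
  -- the fibre over `w`.
  have hcount : ∀ w, ∑' i, (g '' W i).indicator (1 : ℂ → ENNReal) w ≤ m := fun w => by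
    refine ENNReal.summable.tsum_le_of_sum_le fun F => ?_
    classical
    simp only [indicator_apply, Pi.one_apply, Finset.sum_boole]
    set F' := F.filter fun i => w ∈ g '' W i
    have hF' : ∀ i ∈ F', ∃ z, z ∈ W i ∧ g z = w := fun i hi => (Finset.mem_filter.1 hi).2
    choose! z hzW hzw using hF'
    have hinj : InjOn z F' := fun i hi j hj hij => by
      by_contra hne
      exact disjoint_left.1 (hWd hne) (hzW i hi) (hij ▸ hzW j hj)
    have hle : (F' : Set ℕ).encard ≤ m := by
      rw [← hinj.encard_image]
      refine (encard_le_encard ?_).trans (hfib w)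
      rintro _ ⟨i, hi, rfl⟩
      exact ⟨hsub i (hzW i hi), hzw i hi⟩
    rw [encard_coe_eq_coe_finsetCard] at hle
    exact_mod_cast hle
  calc ENNReal.ofReal (δ ^ 2) * volume S
      = ∑' i, ENNReal.ofReal (δ ^ 2) * volume (W i) := by
        rw [← hWS, measure_iUnion hWd hWm, ENNReal.tsum_mul_left]
    _ ≤ ∑' i, volume (g '' W i) := ENNReal.tsum_le_tsum hpiece
    _ = ∑' i, ∫⁻ w in B, (g '' W i).indicator 1 w := by
        refine tsum_congr fun i => ?_
        rw [lintegral_indicator_one (himm i), Measure.restrict_apply (himm i), inter_eq_left.2]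
        exact ((hmaps.mono_left (hsub i))).image_subset
    _ = ∫⁻ w in B, ∑' i, (g '' W i).indicator 1 w :=
        (lintegral_tsum fun i => (measurable_one.indicator (himm i)).aemeasurable).symm
    _ ≤ ∫⁻ _ in B, m := lintegral_mono hcount
    _ = m * volume B := setLIntegral_const _ _

/-! ### Newton quotients of polynomials -/

open Polynomial in
/-- The points where the Newton quotient `p / p'` of a polynomial of degree at most `m` is small
and has derivative far from zero form a set of small area. -/
theorem volume_setOf_newton_le (p : ℂ[X]) {m : ℕ} (hm : p.natDegree ≤ m) {r : ℝ} :
    volume {z : ℂ | p.derivative.eval z ≠ 0 ∧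
      ‖p.eval z‖ < r * ‖p.derivative.eval z‖ ∧
      2 * (‖p.eval z‖ * ‖p.derivative.derivative.eval z‖) < ‖p.derivative.eval z‖ ^ 2}
      ≤ 4 * (m * volume (Metric.ball (0 : ℂ) r)) := by
  set S := {z : ℂ | p.derivative.eval z ≠ 0 ∧
      ‖p.eval z‖ < r * ‖p.derivative.eval z‖ ∧
      2 * (‖p.eval z‖ * ‖p.derivative.derivative.eval z‖) < ‖p.derivative.eval z‖ ^ 2}
  rcases S.eq_empty_or_nonempty with hS0 | ⟨z₀, hz₀⟩
  · simp [hS0]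
  have hd0 : p.derivative ≠ 0 := fun h => hz₀.1 (by simp [h])
  have hSo : IsOpen S := by
    have h0 := p.continuous
    have h1 := p.derivative.continuous
    have h2 := p.derivative.derivative.continuous
    exact (isOpen_ne_fun h1 continuous_const).inter
      ((isOpen_lt h0.norm (continuous_const.mul h1.norm)).inter
        (isOpen_lt (continuous_const.mul (h0.norm.mul h2.norm)) (h1.norm.pow 2)))
  have hder : ∀ z ∈ S, HasDerivAt (fun z => p.eval z / p.derivative.eval z)
      (1 - p.eval z * p.derivative.derivative.eval z / p.derivative.eval z ^ 2) z := fun z hz => by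
    refine ((p.hasDerivAt z).fun_div (p.derivative.hasDerivAt z) hz.1).congr_deriv ?_
    rw [← div_self (pow_ne_zero 2 hz.1)]
    ring
  have key := volume_le_of_encard_fiber_le (g := fun z => p.eval z / p.derivative.eval z)
    (S := S) (B := Metric.ball 0 r) (δ := 1 / 2) (m := m) (by norm_num) hSo
    (fun z hz => (hder z hz).differentiableAt.differentiableWithinAt) ?_ ?_
    ?_
  · calc volume S = 4 * (ENNReal.ofReal ((1 / 2) ^ 2) * volume S) := by
          rw [← mul_assoc, show (4 : ENNReal) = ENNReal.ofReal 4 by simp,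
            ← ENNReal.ofReal_mul (by norm_num)]
          norm_num
      _ ≤ _ := by gcongr
  · intro z hz
    rw [(hder z hz).deriv]
    have hpos : 0 < ‖p.derivative.eval z‖ := norm_pos_iff.2 hz.1
    have h1 : ‖p.eval z * p.derivative.derivative.eval z / p.derivative.eval z ^ 2‖ ≤ 1 / 2 := by
      rw [norm_div, norm_mul, norm_pow, div_le_iff₀ (by positivity)]
      linarith [hz.2.2]
    have h2 := norm_sub_norm_le (1 : ℂ)
      (p.eval z * p.derivative.derivative.eval z / p.derivative.eval z ^ 2)
    rw [norm_one] at h2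
    linarith
  · intro w
    -- The fibre over `w` consists of roots of `p - w p'`, which is nonzero because `p'` has smaller
    -- degree than `p`.
    have hq : p - C w * p.derivative ≠ 0 := fun h => by
      have hp : p ≠ 0 := fun h => hd0 (by simp [h])
      have hlt := degree_derivative_lt hp
      have hle : (C w * p.derivative).degree ≤ p.derivative.degree :=
        C_mul' w p.derivative ▸ degree_smul_le w _
      rw [← sub_eq_zero.1 h] at hle
      exact absurd hlt (not_lt.2 hle)
    have hsub : S ∩ (fun z => p.eval z / p.derivative.eval z) ⁻¹' {w} ⊆
        ((p - C w * p.derivative).roots.toFinset : Set ℂ) := by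
      rintro z ⟨hz, hzw⟩
      have hzw : p.eval z / p.derivative.eval z = w := hzw
      rw [div_eq_iff hz.1] at hzw
      simp [hq, hzw]
    refine (encard_le_encard hsub).trans ?_
    rw [encard_coe_eq_coe_finsetCard]
    have h1 : (p - C w * p.derivative).natDegree ≤ m := by
      refine (natDegree_sub_le _ _).trans (max_le hm ?_)
      exact (natDegree_C_mul_le _ _).trans ((natDegree_derivative_le p).trans (by omega))
    exact_mod_cast (Multiset.toFinset_card_le _).trans ((card_roots' _).trans h1)
  · intro z hz
    rw [mem_ball_zero_iff, norm_div, div_lt_iff₀ (norm_pos_iff.2 hz.1)]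
    exact hz.2.1

/-! ### Measure of the parameter regions and Borel–Cantelli -/

/-- Pairs `(c, t)` for which `t ^ n` times the values at `c` of three consecutive members of a
sequence of polynomials satisfy the open conditions that isolate a zero of the last one. -/
def newtonRegion (P : ℕ → Polynomial ℂ) (n : ℕ) : Set (ℂ × ℝ) :=
  {q | q.2 ∈ Ioo (1 : ℝ) 2 ∧ q.2 ^ n * ‖(P n).eval q.1‖ < 1 / 8 ∧
    1 / 2 < q.2 ^ n * ‖(P (n + 1)).eval q.1‖ ∧ q.2 ^ n * ‖(P (n + 1)).eval q.1‖ < 2 ∧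
    q.2 ^ n * ‖(P (n + 2)).eval q.1‖ < 1}

theorem isOpen_newtonRegion (P : ℕ → Polynomial ℂ) (n : ℕ) : IsOpen (newtonRegion P n) := by
  have h : ∀ k, Continuous fun q : ℂ × ℝ => q.2 ^ n * ‖(P k).eval q.1‖ := fun k =>
    (continuous_snd.pow n).mul ((P k).continuous.comp continuous_fst).norm
  exact (isOpen_Ioo.preimage continuous_snd).inter ((isOpen_lt (h _) continuous_const).inter
    ((isOpen_lt continuous_const (h _)).inter ((isOpen_lt (h _) continuous_const).inter
      (isOpen_lt (h _) continuous_const))))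

/-- The parameters `t ∈ (1, 2)` for which `t ^ n * A` lies in `(1 / 2, 2)` form a set of length
`O(1 / n)`. -/
theorem volume_setOf_pow_mul_le (A : ℝ) (n : ℕ) :
    volume {t : ℝ | t ∈ Ioo (1 : ℝ) 2 ∧ 1 / 2 < t ^ n * A ∧ t ^ n * A < 2} ≤
      ENNReal.ofReal (14 / (n + 1)) := by
  have key : ∀ s t : ℝ, s ∈ Ioo (1 : ℝ) 2 → t ∈ Ioo (1 : ℝ) 2 → 1 / 2 < s ^ n * A →
      t ^ n * A < 2 → t - s ≤ 14 / (n + 1) := fun s t hs ht hsA htA => by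
    have hs0 : 0 < s := by linarith [hs.1]
    have ht0 : 0 < t := by linarith [ht.1]
    rw [le_div_iff₀ (by positivity)]
    have hq : (t / s) ^ n < 4 := by
      rw [div_pow, div_lt_iff₀ (by positivity)]
      by_contra! h
      have hA : 0 < A := pos_of_mul_pos_right (by linarith) (pow_pos hs0 n).le
      nlinarith
    have hq' : t / s < 2 := by rw [div_lt_iff₀ hs0]; linarith [hs.1, ht.2]
    -- Bernoulli's inequality with exponent `n + 1` gives `(n + 1) (t / s - 1) < 7`; multiplying by
    -- `s < 2` gives `14`.
    have h8 : (t / s) ^ (n + 1) < 8 := by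
      rw [pow_succ]
      have : 0 < t / s := by positivity
      have : 0 < (t / s) ^ n := by positivity
      nlinarith
    have hb := one_add_mul_sub_le_pow (a := t / s) (by linarith [div_pos ht0 hs0]) (n + 1)
    push_cast at hb
    have h7 : (n + 1 : ℝ) * (t / s - 1) < 7 := by linarith
    have e : t - s = s * (t / s - 1) := by field_simp
    rw [e]
    rcases le_total 0 (t / s - 1) with h | h
    · nlinarith [hs.2, mul_nonneg (by positivity : (0 : ℝ) ≤ n + 1) h]
    · have : s * (t / s - 1) ≤ 0 := mul_nonpos_of_nonneg_of_nonpos hs0.le h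
      nlinarith [mul_nonneg_of_nonpos_of_nonpos this (by 
        linarith [Nat.cast_nonneg (α := ℝ) n] : -((n : ℝ) + 1) ≤ 0)]
  refine (Real.volume_le_diam _).trans (Metric.ediam_le fun s hs t ht => ?_)
  rw [edist_dist, Real.dist_eq]
  refine ENNReal.ofReal_le_ofReal (abs_sub_le_iff.2 ⟨?_, ?_⟩)
  · exact key t s ht.1 hs.1 ht.2.1 hs.2.2
  · exact key s t hs.1 ht.1 hs.2.1 ht.2.2

-- Fubini: the `c`-projection lies in the Newton set of `P (n + 2)`, of area at most `16 π / (n +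
-- 2)`, and each `t`-slice has length at most `14 / (n + 1)`; `224 = 14 * 16`.
open Polynomial in
theorem volume_newtonRegion_le {P : ℕ → ℂ[X]} (hdeg : ∀ n, (P n).natDegree ≤ n)
    (hder : ∀ n, derivative (P (n + 1)) = C ((n : ℂ) + 1) * P n) (n : ℕ) :
    volume (newtonRegion P n) ≤ ENNReal.ofReal (224 * Real.pi / ((n : ℝ) + 1) ^ 2) := by
  set S := {z : ℂ | (P (n + 2)).derivative.eval z ≠ 0 ∧
      ‖(P (n + 2)).eval z‖ < 2 / (n + 2) * ‖(P (n + 2)).derivative.eval z‖ ∧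
      2 * (‖(P (n + 2)).eval z‖ * ‖(P (n + 2)).derivative.derivative.eval z‖) <
        ‖(P (n + 2)).derivative.eval z‖ ^ 2}
  have hd1 : ∀ z, (P (n + 2)).derivative.eval z = (n + 2) * (P (n + 1)).eval z := fun z => by
    rw [hder, eval_mul, eval_C]
    push_cast
    ring
  have hd2 : ∀ z, (P (n + 2)).derivative.derivative.eval z =
      (n + 2) * ((n + 1) * (P n).eval z) := fun z => by
    rw [hder, derivative_C_mul, hder, eval_mul, eval_mul, eval_C, eval_C]
    push_cast
    ring
  have hn1 : ‖((n : ℂ) + 1)‖ = n + 1 := by exact_mod_cast Complex.norm_natCast (n + 1)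
  have hn2 : ‖((n : ℂ) + 2)‖ = n + 2 := by exact_mod_cast Complex.norm_natCast (n + 2)
  have hS : ∀ q ∈ newtonRegion P n, q.1 ∈ S := by
    rintro ⟨c, t⟩ ⟨ht, h0, h1, -, h2⟩
    simp only at ht h0 h1 h2 ⊢
    have hs : 0 < t ^ n := pow_pos (by linarith [ht.1]) n
    have hP1 : 0 < ‖(P (n + 1)).eval c‖ := pos_of_mul_pos_right (by linarith) hs.le
    refine ⟨?_, ?_, ?_⟩
    · rw [hd1, ← norm_pos_iff, norm_mul, hn2]
      positivity
    · rw [hd1, norm_mul, hn2, ← mul_assoc, div_mul_cancel₀ _ (by positivity)]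
      refine lt_of_mul_lt_mul_left (a := t ^ n) ?_ hs.le
      linarith
    · rw [hd1, hd2, norm_mul, norm_mul, norm_mul, hn2, hn1]
      set x := ‖(P n).eval c‖
      set y := ‖(P (n + 1)).eval c‖
      set w := ‖(P (n + 2)).eval c‖
      have hx : 0 ≤ x := norm_nonneg _
      have hw : 0 ≤ w := norm_nonneg _
      refine lt_of_mul_lt_mul_left (a := (t ^ n) ^ 2) ?_ (by positivity)
      have hxw : (t ^ n * x) * (t ^ n * w) ≤ 1 / 8 * 1 := by gcongr
      have hy : (1 / 2 : ℝ) ^ 2 < (t ^ n * y) ^ 2 := by gcongr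
      have hN : ((n : ℝ) + 2) * (n + 1) ≤ (n + 2) ^ 2 := by nlinarith [Nat.cast_nonneg (α := ℝ) n]
      calc (t ^ n) ^ 2 * (2 * (w * ((n + 2) * ((n + 1) * x))))
          = 2 * (((n : ℝ) + 2) * (n + 1)) * ((t ^ n * x) * (t ^ n * w)) := by ring
        _ ≤ 2 * ((n : ℝ) + 2) ^ 2 * (1 / 8 * 1) := by gcongr
        _ = ((n : ℝ) + 2) ^ 2 * (1 / 2) ^ 2 := by ring
        _ < ((n : ℝ) + 2) ^ 2 * (t ^ n * y) ^ 2 := by gcongr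
        _ = (t ^ n) ^ 2 * ((n + 2) * y) ^ 2 := by ring
  have hSvol : volume S ≤ ENNReal.ofReal (16 * Real.pi / (n + 2)) := by
    refine (volume_setOf_newton_le (P (n + 2)) (hdeg _)).trans (le_of_eq ?_)
    rw [Complex.volume_ball, ← ENNReal.ofReal_pow (by positivity),
      show (4 : ENNReal) = ENNReal.ofReal 4 by simp, ← ENNReal.ofReal_natCast,
      show ((NNReal.pi : NNReal) : ENNReal) = ENNReal.ofReal Real.pi from
        (ENNReal.ofReal_coe_nnreal (p := NNReal.pi)).symm,
      ← ENNReal.ofReal_mul (by positivity), ← ENNReal.ofReal_mul (by positivity),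
      ← ENNReal.ofReal_mul (by positivity)]
    congr 1
    push_cast
    field_simp
    norm_num
  -- The measurable hull has the same volume as `S`, so measurability of `S` itself is not needed.
  have hSm : MeasurableSet (toMeasurable volume S) := measurableSet_toMeasurable _ _
  rw [Measure.volume_eq_prod, Measure.prod_apply (isOpen_newtonRegion P n).measurableSet]
  calc ∫⁻ c, volume (Prod.mk c ⁻¹' newtonRegion P n)
      ≤ ∫⁻ c, (toMeasurable volume S).indicator (fun _ => ENNReal.ofReal (14 / (n + 1))) c := by
        refine lintegral_mono fun c => ?_
        by_cases hc : c ∈ toMeasurable volume S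
        · rw [indicator_of_mem hc]
          refine (measure_mono ?_).trans (volume_setOf_pow_mul_le ‖(P (n + 1)).eval c‖ n)
          rintro t ⟨ht, -, h1, h2, -⟩
          exact ⟨ht, h1, h2⟩
        · rw [indicator_of_notMem hc, nonpos_iff_eq_zero]
          have : Prod.mk c ⁻¹' newtonRegion P n = ∅ := eq_empty_of_forall_notMem fun t ht =>
            hc (subset_toMeasurable _ _ (hS _ ht))
          rw [this, measure_empty]
    _ = ENNReal.ofReal (14 / (n + 1)) * volume S := by
        rw [lintegral_indicator_const hSm, measure_toMeasurable]
    _ ≤ ENNReal.ofReal (14 / (n + 1)) * ENNReal.ofReal (16 * Real.pi / (n + 2)) := by gcongr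
    _ = ENNReal.ofReal (14 / (n + 1) * (16 * Real.pi / (n + 2))) :=
        (ENNReal.ofReal_mul (by positivity)).symm
    _ ≤ ENNReal.ofReal (224 * Real.pi / ((n : ℝ) + 1) ^ 2) := by
        refine ENNReal.ofReal_le_ofReal ?_
        rw [div_mul_div_comm, ← mul_assoc]
        have := Real.pi_pos
        norm_num
        gcongr
        nlinarith [Nat.cast_nonneg (α := ℝ) n]

open Polynomial in
/-- For a sequence of polynomials with `P (n + 1)' = (n + 1) P n`, almost every point lies in only
finitely many of the regions `newtonRegion P n`. -/
theorem ae_eventually_notMem_newtonRegion {P : ℕ → ℂ[X]} (hdeg : ∀ n, (P n).natDegree ≤ n)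
    (hder : ∀ n, derivative (P (n + 1)) = C ((n : ℂ) + 1) * P n) :
    ∀ᵐ q : ℂ × ℝ, ∀ᶠ n in atTop, q ∉ newtonRegion P n := by
  refine ae_eventually_notMem (ne_top_of_le_ne_top ?_
    (ENNReal.tsum_le_tsum (volume_newtonRegion_le hdeg hder)))
  refine Summable.tsum_ofReal_ne_top ?_
  have h := ((summable_nat_add_iff 1).2 (Real.summable_one_div_nat_pow.2 one_lt_two)).mul_left
    (224 * Real.pi)
  refine h.congr fun n => ?_
  push_cast
  ring

/-! ### The Appell polynomials of an operator -/

section Operator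

variable {X : Type*} [AddCommGroup X] [Module ℂ X] [TopologicalSpace X]
  [IsTopologicalAddGroup X]

open Polynomial in
/-- The polynomial `c ↦ φ ((T + c I) ^ n x)`. -/
noncomputable def translatePolynomial (T : X →L[ℂ] X) (φ : X →L[ℂ] ℂ) (x : X) (n : ℕ) : ℂ[X] :=
  ∑ j ∈ Finset.range (n + 1), C ((n.choose j : ℂ) * φ ((T ^ j) x)) * Polynomial.X ^ (n - j)

theorem eval_translatePolynomial [ContinuousSMul ℂ X] (T : X →L[ℂ] X) (φ : X →L[ℂ] ℂ) (x : X)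
    (n : ℕ) (c : ℂ) :
    (translatePolynomial T φ x n).eval c =
      φ (((T + c • ContinuousLinearMap.id ℂ X) ^ n) x) := by
  have hcomm : Commute T (c • (1 : X →L[ℂ] X)) := (Commute.one_right T).smul_right c
  have hid : ContinuousLinearMap.id ℂ X = 1 := rfl
  rw [hid, hcomm.add_pow, translatePolynomial, Polynomial.eval_finsetSum,
    sum_apply, map_sum]
  refine Finset.sum_congr rfl fun j _ => ?_
  rw [smul_pow, one_pow, mul_smul_comm, mul_one, smul_mul_assoc, ← nsmul_eq_mul',
    smul_apply, smul_apply, map_smul, map_nsmul]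
  simp
  ring

theorem natDegree_translatePolynomial_le (T : X →L[ℂ] X) (φ : X →L[ℂ] ℂ) (x : X) (n : ℕ) :
    (translatePolynomial T φ x n).natDegree ≤ n :=
  Polynomial.natDegree_sum_le_of_forall_le _ _ fun j _ =>
    (Polynomial.natDegree_C_mul_X_pow_le _ _).trans (Nat.sub_le n j)

open Polynomial in
theorem derivative_translatePolynomial_succ (T : X →L[ℂ] X) (φ : X →L[ℂ] ℂ) (x : X) (n : ℕ) :
    derivative (translatePolynomial T φ x (n + 1)) =
      C ((n : ℂ) + 1) * translatePolynomial T φ x n := by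
  rw [translatePolynomial, Finset.sum_range_succ, derivative_add, derivative_sum,
    translatePolynomial, Finset.mul_sum]
  simp only [Nat.sub_self, pow_zero, mul_one, derivative_C, add_zero]
  refine Finset.sum_congr rfl fun j hj => ?_
  have hj : j ≤ n := Nat.lt_succ_iff.1 (Finset.mem_range.1 hj)
  have hch : ((n + 1).choose j : ℂ) * ((n + 1 - j : ℕ) : ℂ) = ((n : ℂ) + 1) * n.choose j := by
    have := Nat.choose_mul_succ_eq n j
    have h2 : (n.choose j : ℂ) * (n + 1) = (n + 1).choose j * ((n + 1 - j : ℕ) : ℂ) := by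
      exact_mod_cast this
    rw [← h2, mul_comm]
  rw [derivative_C_mul_X_pow, ← mul_assoc, ← C_mul, show n + 1 - j - 1 = n - j by omega]
  congr 2
  linear_combination φ ((T ^ j) x) * hch

end Operator

/-! ### The abstract criterion -/

section NoCommon

variable {X : Type*} [AddCommGroup X] [Module ℂ X] [TopologicalSpace X]
  [IsTopologicalAddGroup X] [ContinuousSMul ℂ X]

/-- A dense orbit in a nontrivial `T₁` space visits every nonempty open set infinitely often. -/
theorem frequently_mem_of_mem_hypercyclicVectors [T1Space X] [Nontrivial X] {T : X →L[ℂ] X} {x : X}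
    (hx : x ∈ hypercyclicVectors T) {U : Set X} (hU : IsOpen U) (hne : U.Nonempty) :
    ∃ᶠ n in atTop, (T ^ n) x ∈ U := by
  have : ∀ y : X, NeBot (𝓝[≠] y) := fun y => Module.punctured_nhds_neBot ℂ X y
  refine frequently_atTop.2 fun N => ?_
  -- There are no isolated points, so deleting finitely many orbit points keeps density.
  have hd : Dense (range (fun n : ℕ => (T ^ n) x) \ (fun n : ℕ => (T ^ n) x) '' Iio N) :=
    Dense.sdiff_finite hx ((finite_Iio N).image _)
  obtain ⟨_, hyU, ⟨n, rfl⟩, hn⟩ := hd.inter_open_nonempty U hU hne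
  exact ⟨n, not_lt.1 fun h => hn (mem_image_of_mem _ h), hyU⟩

/-- A point of the orbit of `t (T + c I)` close enough to a vector `u` with `φ u = 0`,
`φ (T u) = 1`, `φ (T (T u)) = 0` puts `(c, t)` into the corresponding region. -/
theorem mem_newtonRegion_of_pow_apply {T : X →L[ℂ] X} {φ : X →L[ℂ] ℂ} {x : X} {c : ℂ} {t : ℝ}
    {n : ℕ} (hc : ‖c‖ < 1 / 20) (ht : t ∈ Ioo (1 : ℝ) 2)
    (h0 : ‖φ ((((t : ℂ) • (T + c • ContinuousLinearMap.id ℂ X)) ^ n) x)‖ < 1 / 20)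
    (h1 : ‖φ (T ((((t : ℂ) • (T + c • ContinuousLinearMap.id ℂ X)) ^ n) x)) - 1‖ < 1 / 20)
    (h2 : ‖φ (T (T ((((t : ℂ) • (T + c • ContinuousLinearMap.id ℂ X)) ^ n) x)))‖ < 1 / 20) :
    (c, t) ∈ newtonRegion (translatePolynomial T φ x) n := by
  have ht0 : 0 < t := by linarith [ht.1]
  set S := T + c • ContinuousLinearMap.id ℂ X with hS
  set y := (((t : ℂ) • S) ^ n) x with hy
  have hSa : ∀ v, S v = T v + c • v := fun v => rfl
  have hyS : y = (t : ℂ) ^ n • (S ^ n) x := by rw [hy, smul_pow, smul_apply]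
  -- The scalar is `t ^ n` for every `k`: the extra factor `S ^ k` acts on `y` without the dilation
  -- `t`.
  have hnorm : ∀ k, t ^ n * ‖(translatePolynomial T φ x (n + k)).eval c‖ = ‖φ ((S ^ k) y)‖ :=
    fun k => by
      rw [eval_translatePolynomial, ← hS, hyS, map_smul, map_smul, norm_smul, norm_pow,
        Complex.norm_real, Real.norm_of_nonneg ht0.le, add_comm n k, pow_add]
      rfl
  have e1 : φ ((S ^ 1) y) = 1 + ((φ (T y) - 1) + c * φ y) := by
    rw [pow_one, hSa, map_add, map_smul, smul_eq_mul]
    ring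
  have e2 : φ ((S ^ 2) y) = φ (T (T y)) + 2 * c * (1 + (φ (T y) - 1)) + c * (c * φ y) := by
    rw [pow_two, mul_apply_eq_comp, hSa, hSa]
    simp only [map_add, map_smul, smul_eq_mul]
    ring
  have hcφ : ‖c * φ y‖ ≤ 1 / 20 * (1 / 20) := by
    rw [norm_mul]
    gcongr
  have hb : ‖(φ (T y) - 1) + c * φ y‖ ≤ 1 / 4 := by
    linarith [norm_add_le (φ (T y) - 1) (c * φ y)]
  refine ⟨ht, ?_, ?_, ?_, ?_⟩
  · have := hnorm 0
    rw [add_zero, pow_zero] at this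
    refine this.trans_lt (lt_of_lt_of_le h0 (by norm_num))
  · refine lt_of_lt_of_eq ?_ (hnorm 1).symm
    rw [e1]
    have := norm_sub_le_norm_add (1 : ℂ) ((φ (T y) - 1) + c * φ y)
    rw [norm_one] at this
    linarith
  · refine (hnorm 1).trans_lt ?_
    rw [e1]
    have := norm_add_le (1 : ℂ) ((φ (T y) - 1) + c * φ y)
    rw [norm_one] at this
    linarith
  · refine (hnorm 2).trans_lt ?_
    rw [e2]
    have a1 := norm_add₃_le (a := φ (T (T y))) (b := 2 * c * (1 + (φ (T y) - 1)))
      (c := c * (c * φ y))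
    have a2 : ‖2 * c * (1 + (φ (T y) - 1))‖ ≤ 2 * (1 / 20) * (1 + 1 / 20) := by
      rw [norm_mul, norm_mul, Complex.norm_ofNat]
      have := norm_add_le (1 : ℂ) (φ (T y) - 1)
      rw [norm_one] at this
      gcongr
      linarith
    have a3 : ‖c * (c * φ y)‖ ≤ 1 / 20 * (1 / 20 * (1 / 20)) := by
      rw [norm_mul]
      gcongr
    linarith

/-- If some continuous functional `φ` and vector `u` satisfy `φ u = 0`, `φ (T u) = 1` and
`φ (T (T u)) = 0`, then the operators `a T + b I`, `a > 0`, have no common hypercyclic vector. -/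
theorem commonHypercyclicVectors_smul_add_smul_id_eq_empty [T1Space X] (T : X →L[ℂ] X)
    (φ : X →L[ℂ] ℂ) (u : X) (h0 : φ u = 0) (h1 : φ (T u) = 1) (h2 : φ (T (T u)) = 0) :
    commonHypercyclicVectors {S : X →L[ℂ] X | ∃ (a : ℝ) (b : ℂ), 0 < a ∧
      S = (a : ℂ) • T + b • ContinuousLinearMap.id ℂ X} = ∅ := by
  refine eq_empty_of_forall_notMem fun x hx => ?_
  have hx : ∀ S : X →L[ℂ] X, (∃ (a : ℝ) (b : ℂ), 0 < a ∧
      S = (a : ℂ) • T + b • ContinuousLinearMap.id ℂ X) → x ∈ hypercyclicVectors S :=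
    fun S hS => mem_iInter₂.1 hx S hS
  have : Nontrivial X := ⟨u, 0, fun h => by simp [h] at h1⟩
  have hUo : IsOpen {v : X | ‖φ v‖ < 1 / 20 ∧ ‖φ (T v) - 1‖ < 1 / 20 ∧ ‖φ (T (T v))‖ < 1 / 20} := by
    have c0 : Continuous fun v => ‖φ v‖ := by fun_prop
    have c1 : Continuous fun v => ‖φ (T v) - 1‖ := by fun_prop
    have c2 : Continuous fun v => ‖φ (T (T v))‖ := by fun_prop
    exact (isOpen_lt c0 continuous_const).inter
      ((isOpen_lt c1 continuous_const).inter (isOpen_lt c2 continuous_const))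
  have hfreq : ∀ q ∈ Metric.ball (0 : ℂ) (1 / 20) ×ˢ Ioo (1 : ℝ) 2,
      ∃ᶠ n in atTop, q ∈ newtonRegion (translatePolynomial T φ x) n := by
    rintro ⟨c, t⟩ ⟨hc, ht⟩
    -- The pair `(c, t)` corresponds to `a = t`, `b = t c`.
    have hmem := hx ((t : ℂ) • (T + c • ContinuousLinearMap.id ℂ X))
      ⟨t, t * c, by linarith [ht.1], by rw [smul_add, smul_smul]⟩
    refine (frequently_mem_of_mem_hypercyclicVectors hmem hUo ⟨u, by simp [h0, h1, h2]⟩).mono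
      fun n hn => ?_
    exact mem_newtonRegion_of_pow_apply (mem_ball_zero_iff.1 hc) ht hn.1 hn.2.1 hn.2.2
  have hae := ae_eventually_notMem_newtonRegion (natDegree_translatePolynomial_le T φ x)
    (derivative_translatePolynomial_succ T φ x)
  have hzero : volume (Metric.ball (0 : ℂ) (1 / 20) ×ˢ Ioo (1 : ℝ) 2) = 0 :=
    measure_mono_null (fun q hq => hfreq q hq) hae
  exact ((Metric.isOpen_ball.prod isOpen_Ioo).measure_pos volume
    ⟨(0, 3 / 2), Metric.mem_ball_self (by norm_num), by norm_num, by norm_num⟩).ne' hzero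

end NoCommon

/-! ### Application to differentiation on entire functions -/

namespace EntireFunctions

instance : T1Space EntireFunctions := inferInstanceAs (T1Space entireSubmodule)

/-- Evaluation at a point as a continuous linear functional on `H(ℂ)`. -/
noncomputable def evalCLM (z : ℂ) : EntireFunctions →L[ℂ] ℂ where
  toFun f := f z
  map_add' _ _ := rfl
  map_smul' _ _ := rfl
  cont := (continuous_eval_const (F := C(ℂ, ℂ)) z).comp continuous_subtype_val

theorem D_apply (f : EntireFunctions) (z : ℂ) : D f z = deriv f z := rfl

theorem deriv_mk_id : deriv (mk id differentiable_id) = fun _ => 1 := deriv_id'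

theorem D_mk_id_apply (z : ℂ) : D (mk id differentiable_id) z = 1 := congrFun deriv_mk_id z

theorem D_D_mk_id_apply (z : ℂ) : D (D (mk id differentiable_id)) z = 0 := by
  rw [D_apply, show ⇑(D (mk id differentiable_id)) = fun _ => 1 from funext D_mk_id_apply,
    deriv_const]

/-- `a D + b I` with `a ≠ 0` is not a scalar multiple of the identity. -/
theorem smul_D_add_smul_id_ne_smul_id {a : ℂ} (ha : a ≠ 0) (b c : ℂ) :
    a • D + b • ContinuousLinearMap.id ℂ EntireFunctions ≠ c • ContinuousLinearMap.id ℂ _ := by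
  intro h
  have hv : ∀ f : EntireFunctions, ∀ z, a * D f z + b * f z = c * f z := fun f z =>
    congrArg (evalCLM z) (congrArg (fun S : EntireFunctions →L[ℂ] EntireFunctions => S f) h)
  have := hv (mk id differentiable_id) 0
  rw [D_mk_id_apply, show mk id differentiable_id 0 = 0 from rfl] at this
  simp [ha] at this

end EntireFunctions

theorem mainTheorem11 :
    commonHypercyclicVectors
        {T : EntireFunctions →L[ℂ] EntireFunctions | ∃ (a : ℝ) (b : ℂ), 0 < a ∧
          T = (a : ℂ) • EntireFunctions.D + b • ContinuousLinearMap.id ℂ EntireFunctions}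
      = ∅ ∧
    commonHypercyclicVectors
        {T : EntireFunctions →L[ℂ] EntireFunctions |
          (¬ ∃ c : ℂ, T = c • ContinuousLinearMap.id ℂ EntireFunctions) ∧
          T ∘L EntireFunctions.D = EntireFunctions.D ∘L T}
      = ∅ := by
  -- Here `φ` is evaluation at `0` and `u (z) = z`, so `u`, `u'`, `u''` take the values `0`, `1`,
  -- `0` at the origin.
  have hfirst := commonHypercyclicVectors_smul_add_smul_id_eq_empty EntireFunctions.D
    (EntireFunctions.evalCLM 0) (EntireFunctions.mk id differentiable_id) rfl
    (EntireFunctions.D_mk_id_apply 0) (EntireFunctions.D_D_mk_id_apply 0)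
  refine ⟨hfirst, subset_empty_iff.1 (subset_trans ?_ hfirst.subset)⟩
  -- A larger family has fewer common hypercyclic vectors, so it suffices that the first family lies
  -- in the second.
  refine biInter_subset_biInter_left ?_
  rintro _ ⟨a, b, ha, rfl⟩
  refine ⟨fun ⟨c, hc⟩ => EntireFunctions.smul_D_add_smul_id_ne_smul_id
    (Complex.ofReal_ne_zero.2 ha.ne') b c hc, ?_⟩
  ext1 f
  change (a : ℂ) • EntireFunctions.D (EntireFunctions.D f) + b • EntireFunctions.D f =
    EntireFunctions.D ((a : ℂ) • EntireFunctions.D f + b • f)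
  rw [map_add, map_smul, map_smul]
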